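/- Let $G$ be a compact Lie group acting smoothly on a compact (Hausdorff) smooth manifold with corners $M$ of dimension $n$, i.e. $M$ is covered by charts onto relatively open subsets of $[0,\infty)^n$ with smooth transition maps, and the action map $G\times M\to M$, $(g,x)\mapsto gx$, is smooth. Suppose that the action is free on the interior of $M$: for every interior point $x$ (one that the charts send to a point of $(0,\infty)^n$), the isotropy group $G_x=\{g\in G : gx=x\}$ is trivial. Then the action is free on all of $M$: $G_x=\{1\}$ for every $x\in M$. -/

import Mathlib

open scoped Manifold ContDiff

/-- The action of `G` on `X` is free on the subset `S`: every point of `S` has trivial isotropy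
group. -/
def ActsFreelyOn (G : Type*) {X : Type*} [Group G] [MulAction G X] (S : Set X) : Prop :=
  ∀ x ∈ S, MulAction.stabilizer G x = ⊥

open MeasureTheory MeasureTheory.Measure Filter Topology Set Metric

/-! The point is that a compact group `K` fixing `x` also fixes interior points near `x`; with `K`
the stabilizer of `x`, freeness at such a point forces `K` to be trivial. In a chart at `x`, with
image in a quadrant `Q` and `x` sent to `p`, the derivatives at `p` form a continuous representation
`A` of `K` (`exists_monoidHom_of_strict_derivative`). They preserve the cone of inward directions,
so averaging the orbit of `(1, …, 1)` gives an invariant, strictly inward vector `v`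
(`exists_fixed_vector_pos`). Averaging the chart itself gives an equivariant map `f` that, read in
the chart, is Lipschitz-close to the identity near `p`. For small `t > 0` it takes the value `t • v`
at an interior point; equivariance and injectivity of `f` make that point fixed by `K`
(`exists_fixed_point_pos`). At a corner, `f` is only defined on part of `Q`, so quantitative
surjectivity on balls inside `Q` replaces the inverse function theorem. -/

theorem eventually_forall_of_compactSpace {K α : Type*} [TopologicalSpace K] [CompactSpace K]
    {l : Filter α} {P : K → α → Prop} (h : ∀ k, ∀ᶠ q in 𝓝 k ×ˢ l, P q.1 q.2) :
    ∀ᶠ a in l, ∀ k, P k a := by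
  have := isCompact_univ.mem_nhdsSet_prod_of_forall (K := (univ : Set K)) (l := l)
    (s := {q | P q.1 q.2}) fun k _ => h k
  rw [nhdsSet_univ] at this
  rw [mem_prod_iff] at this
  obtain ⟨s, hs, t, ht, hst⟩ := this
  rw [mem_top] at hs
  subst hs
  filter_upwards [ht] with a ha k
  exact hst (mk_mem_prod (mem_univ k) ha)

/-! ### Averaging over a compact group -/

section Averaging

variable {K : Type*} [Group K] [TopologicalSpace K] [IsTopologicalGroup K] [CompactSpace K]
  [MeasurableSpace K] [BorelSpace K]
  {V : Type*} [NormedAddCommGroup V] [NormedSpace ℝ V]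
  {X : Type*} [MulAction K X]

/-- A continuous representation of a compact group has an invariant vector that is positive on every
functional which is nonnegative along the orbit of `v₀` and positive at `v₀`. -/
theorem exists_fixed_vector_pos [CompleteSpace V] (A : K →* (V →L[ℝ] V)) (hA : Continuous A) (v₀ : V) :
    ∃ v, (∀ k, A k v = v) ∧
      ∀ f : V →L[ℝ] ℝ, (∀ k, 0 ≤ f (A k v₀)) → 0 < f v₀ → 0 < f v := by
  set μ : Measure K := haar
  have hc : Continuous fun k => A k v₀ := by fun_prop
  have hi : Integrable (fun k => A k v₀) μ :=
    hc.integrable_of_hasCompactSupport (HasCompactSupport.of_compactSpace _)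
  refine ⟨∫ k, A k v₀ ∂μ, fun l => ?_, fun f h0 h1 => ?_⟩
  · rw [← ContinuousLinearMap.integral_comp_comm _ hi]
    rw [← integral_mul_left_eq_self (μ := μ) (fun k => A k v₀) l]
    simp
  · rw [← ContinuousLinearMap.integral_comp_comm _ hi]
    refine Continuous.integral_pos_of_hasCompactSupport_nonneg_nonzero (x := 1) (by fun_prop)
      (HasCompactSupport.of_compactSpace _) h0 ?_
    simpa using h1.ne'

/-- The average over the Haar measure `μ` of the conjugates of `f` under the action on the source
and the representation `A` on the target. -/
noncomputable def equivariantAverage (μ : Measure K) (A : K →* (V →L[ℝ] V)) (f : X → V) (z : X) :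
    V :=
  ∫ k, A k (f (k⁻¹ • z)) ∂μ

theorem integrable_conjugates (μ : Measure K) [IsFiniteMeasure μ] (A : K →* (V →L[ℝ] V))
    (hA : Continuous A) (f : X → V) (z : X) (hf : Continuous fun k : K => f (k • z)) :
    Integrable (fun k => A k (f (k⁻¹ • z))) μ := by
  have : Continuous fun k : K => f (k⁻¹ • z) := hf.comp continuous_inv
  exact (hA.clm_apply this).integrable_of_hasCompactSupport (HasCompactSupport.of_compactSpace _)

/-- Left invariance of `μ`: substituting `l * k` for `k` pulls `A l` out of the integral. -/
theorem equivariantAverage_smul [CompleteSpace V] (μ : Measure K) [IsFiniteMeasure μ] [IsMulLeftInvariant μ]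
    (A : K →* (V →L[ℝ] V)) (hA : Continuous A) (f : X → V) (z : X)
    (hf : Continuous fun k : K => f (k • z)) (l : K) :
    equivariantAverage μ A f (l • z) = A l (equivariantAverage μ A f z) := by
  unfold equivariantAverage
  rw [← ContinuousLinearMap.integral_comp_comm _ (integrable_conjugates μ A hA f z hf)]
  rw [← integral_mul_left_eq_self (μ := μ) (fun k => A k (f (k⁻¹ • l • z))) l]
  simp [mul_smul]

/-- Each conjugate has linear part `A k * A k⁻¹ = 1`, hence so does the average, as `μ` has mass
one. Applying `A k` to the error costs the factor `C`. -/
theorem equivariantAverage_approximatesLinearOn [CompleteSpace V] (μ : Measure K) [IsProbabilityMeasure μ]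
    (A : K →* (V →L[ℝ] V)) (hA : Continuous A) (f : X → V) (σ : V → X) (s : Set V)
    {C ε : NNReal} (hC : ∀ k, ‖A k‖ ≤ C)
    (hf : ∀ y ∈ s, Continuous fun k : K => f (k • σ y))
    (h : ∀ k, ApproximatesLinearOn (fun y => f (k • σ y)) (A k) s ε) :
    ApproximatesLinearOn (fun y => equivariantAverage μ A f (σ y))
      (ContinuousLinearMap.id ℝ V) s (C * ε) := by
  intro y hy y' hy'
  have h1 := integrable_conjugates μ A hA f (σ y) (hf y hy)
  have h2 := integrable_conjugates μ A hA f (σ y') (hf y' hy')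
  have key : equivariantAverage μ A f (σ y) - equivariantAverage μ A f (σ y')
      - ContinuousLinearMap.id ℝ V (y - y') =
      ∫ k, (A k (f (k⁻¹ • σ y)) - A k (f (k⁻¹ • σ y')) - (y - y')) ∂μ := by
    have h3 : Integrable (fun k => A k (f (k⁻¹ • σ y)) - A k (f (k⁻¹ • σ y'))) μ := h1.sub h2
    rw [integral_sub h3 (integrable_const _), integral_sub h1 h2]
    simp [equivariantAverage]
  rw [key]
  refine (norm_integral_le_of_norm_le_const (C := C * ε * ‖y - y'‖) (ae_of_all _ fun k => ?_)).trans
    (by simp)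
  have e1 : A k (f (k⁻¹ • σ y)) - A k (f (k⁻¹ • σ y')) - (y - y') =
      A k (f (k⁻¹ • σ y) - f (k⁻¹ • σ y') - A k⁻¹ (y - y')) := by
    rw [map_sub, map_sub, ← mul_apply_eq_comp, ← map_mul]
    simp
  rw [e1, mul_assoc]
  exact (A k).le_of_opNorm_le_of_le (hC k) (h k⁻¹ y hy y' hy')

end Averaging

/-! ### Interior fixed points in a quadrant -/

/-- The homothety at `p` of ratio `t / t₀` shrinks a ball around `p + t₀ • v` and keeps it in the
interior by convexity. The radius is linear in `t`, as is the error of the averaged chart it must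
absorb. -/
theorem exists_closedBall_add_smul_subset {V : Type*} [NormedAddCommGroup V] [NormedSpace ℝ V]
    {Q : Set V} (hQ : Convex ℝ Q) {p v : V} (hp : p ∈ Q) {t₀ : ℝ} (ht₀ : 0 < t₀)
    (hv : p + t₀ • v ∈ interior Q) :
    ∃ c > 0, ∀ t, 0 < t → t ≤ t₀ → closedBall (p + t • v) (t * c) ⊆ interior Q := by
  obtain ⟨r, hr, hrQ⟩ := Metric.isOpen_iff.1 isOpen_interior _ hv
  refine ⟨r / 2 / t₀, by positivity, fun t ht htt y hy => ?_⟩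
  have h1 : p + (t₀ / t) • (y - p) ∈ interior Q := by
    apply hrQ
    rw [mem_closedBall, dist_eq_norm] at hy
    rw [mem_ball, dist_eq_norm]
    have : p + (t₀ / t) • (y - p) - (p + t₀ • v) = (t₀ / t) • (y - (p + t • v)) := by
      match_scalars <;> field_simp
      ring
    rw [this, norm_smul, Real.norm_of_nonneg (by positivity)]
    calc t₀ / t * ‖y - (p + t • v)‖ ≤ t₀ / t * (t * (r / 2 / t₀)) := by gcongr
      _ = r / 2 := by field_simp
      _ < r := by linarith
  have h2 := hQ.add_smul_sub_mem_interior hp h1 (t := t / t₀)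
    ⟨by positivity, (div_le_one ht₀).2 htt⟩
  convert h2 using 1
  match_scalars <;> field_simp
  ring

/-- In the local coordinates `e` with values in a quadrant, a compact group that fixes `x` and acts
in a `C¹` manner, with derivative `A` at `x`, has a fixed point in the interior of the quadrant. -/
theorem exists_fixed_point_pos {n : ℕ} {K : Type*} [Group K] [TopologicalSpace K]
    [IsTopologicalGroup K] [CompactSpace K] {X : Type*} [TopologicalSpace X] [MulAction K X]
    [ContinuousSMul K X] (e : PartialEquiv X (EuclideanSpace ℝ (Fin n)))
    (he : IsOpen e.source) (hec : ContinuousOn e e.source) {x : X} (hx : x ∈ e.source)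
    (hfix : ∀ k : K, k • x = x) {Q : Set (EuclideanSpace ℝ (Fin n))}
    (hQ : Q = {y | ∀ i, 0 ≤ y i}) (hmaps : MapsTo e e.source Q)
    (htarget : e.target ∈ 𝓝[Q] e x) (hsymm : ContinuousWithinAt e.symm Q (e x))
    (A : K →* (EuclideanSpace ℝ (Fin n) →L[ℝ] EuclideanSpace ℝ (Fin n))) (hA : Continuous A)
    (hd : ∀ k, ∀ ε > 0, ∀ᶠ q in 𝓝 k ×ˢ (𝓝[Q] e x ×ˢ 𝓝[Q] e x),
      ‖e (q.1 • e.symm q.2.1) - e (q.1 • e.symm q.2.2) - A k (q.2.1 - q.2.2)‖ ≤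
        ε * ‖q.2.1 - q.2.2‖) :
    ∃ z ∈ e.source, (∀ k : K, k • z = z) ∧ e z ∈ interior Q := by
  set p := e x with hp
  have hpQ : p ∈ Q := hmaps hx
  have hsymm_p : e.symm p = x := e.left_inv hx
  have hconv : Convex ℝ Q := hQ ▸ EuclideanQuadrant.convex
  have hint : ∀ y, y ∈ interior Q ↔ ∀ i, 0 < y i := by
    intro y
    rw [hQ, interior_euclideanQuadrant]
    rfl
  obtain ⟨C, hC0, hC⟩ : ∃ C : NNReal, 0 < C ∧ ∀ k, ‖A k‖ ≤ C := by
    obtain ⟨C, hC⟩ := (isCompact_range hA).isBounded.exists_norm_le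
    exact ⟨C.toNNReal + 1, by positivity, fun k =>
      (hC _ (mem_range_self k)).trans ((Real.le_coe_toNNReal C).trans (by simp))⟩
  have hsymm' : Tendsto e.symm (𝓝[Q] p) (𝓝 x) := by
    rw [← hsymm_p]; exact hsymm
  have hact : ∀ k : K, Tendsto (fun q : K × EuclideanSpace ℝ (Fin n) => q.1 • e.symm q.2)
      (𝓝 k ×ˢ 𝓝[Q] p) (𝓝 x) := by
    intro k
    have := (tendsto_fst (f := 𝓝 k) (g := 𝓝[Q] p)).smul (hsymm'.comp tendsto_snd)
    rwa [hfix] at this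
  have hsource : ∀ᶠ y in 𝓝[Q] p, ∀ k : K, k • e.symm y ∈ e.source :=
    eventually_forall_of_compactSpace fun k => (hact k).eventually (he.mem_nhds hx)
  -- uniform strict differentiability
  have huniform : ∀ ε > 0, ∀ᶠ q in 𝓝[Q] p ×ˢ 𝓝[Q] p, ∀ k : K,
      ‖e (k • e.symm q.1) - e (k • e.symm q.2) - A k (q.1 - q.2)‖ ≤ ε * ‖q.1 - q.2‖ := by
    intro ε hε
    refine eventually_forall_of_compactSpace fun k => ?_
    have hAk : ∀ᶠ l in 𝓝 k, ‖A k - A l‖ < ε / 2 := by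
      have : Tendsto (fun l => ‖A k - A l‖) (𝓝 k) (𝓝 ‖A k - A k‖) :=
        ((continuous_const.sub hA).norm).tendsto k
      rw [sub_self, norm_zero] at this
      exact this.eventually (gt_mem_nhds (by positivity))
    filter_upwards [hd k (ε / 2) (by positivity), hAk.prod_inl (𝓝[Q] p ×ˢ 𝓝[Q] p)]
      with ⟨l, y, y'⟩ h1 h2
    have h3 : ‖(A k - A l) (y - y')‖ ≤ ε / 2 * ‖y - y'‖ :=
      (A k - A l).le_of_opNorm_le h2.le _
    calc ‖e (l • e.symm y) - e (l • e.symm y') - A l (y - y')‖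
        = ‖(e (l • e.symm y) - e (l • e.symm y') - A k (y - y')) + (A k - A l) (y - y')‖ := by
          rw [_root_.sub_apply]; congr 1; abel
      _ ≤ ε / 2 * ‖y - y'‖ + ε / 2 * ‖y - y'‖ := (norm_add_le _ _).trans (add_le_add h1 h3)
      _ = ε * ‖y - y'‖ := by ring
  -- an invariant vector pointing inwards
  let v₀ : EuclideanSpace ℝ (Fin n) := WithLp.toLp 2 fun _ => 1
  -- The image under `k` of the ray `p + t • v₀` stays in `Q` and its `i`-th coordinate starts at 0,
  -- so the derivative of that coordinate is nonnegative.
  have hv₀ : ∀ i, p i = 0 → ∀ k : K, 0 ≤ (A k v₀) i := by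
    intro i hi k
    have hline : Tendsto (fun t : ℝ => p + t • v₀) (𝓝[>] 0) (𝓝[Q] p) := by
      refine tendsto_nhdsWithin_iff.2 ⟨?_, ?_⟩
      · have : Tendsto (fun t : ℝ => p + t • v₀) (𝓝 0) (𝓝 (p + (0 : ℝ) • v₀)) :=
          Continuous.tendsto (by fun_prop) _
        rw [zero_smul, add_zero] at this
        exact this.mono_left nhdsWithin_le_nhds
      · filter_upwards [self_mem_nhdsWithin] with t (ht : 0 < t)
        rw [hQ] at hpQ ⊢
        intro j
        have := hpQ j
        simp [v₀]
        positivity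
    have hline' : Tendsto (fun t : ℝ => (p + t • v₀, p)) (𝓝[>] 0) (𝓝[Q] p ×ˢ 𝓝[Q] p) :=
      hline.prodMk (tendsto_const_nhdsWithin hpQ)
    refine le_of_forall_pos_le_add fun ε hε => ?_
    have hε' : 0 < ε / (‖v₀‖ + 1) := by positivity
    obtain ⟨t, h1, h2, ht⟩ := ((hline'.eventually (huniform _ hε')).and
      ((hline.eventually hsource).and self_mem_nhdsWithin)).exists
    replace ht : 0 < t := ht
    have h3 := h1 k
    simp only [hsymm_p, hfix, ← hp, add_sub_cancel_left, map_smul, norm_smul,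
      Real.norm_of_nonneg ht.le] at h3
    have h4 := (abs_le.1 ((PiLp.norm_apply_le _ i).trans h3)).2
    simp only [PiLp.sub_apply, PiLp.smul_apply, hi, smul_eq_mul, sub_zero] at h4
    have h5 : 0 ≤ (e (k • e.symm (p + t • v₀))) i := by
      have := hmaps (h2 k)
      rw [hQ] at this
      exact this i
    have h6 : ε / (‖v₀‖ + 1) * (t * ‖v₀‖) ≤ t * ε := by
      rw [div_mul_eq_mul_div, div_le_iff₀ (by positivity)]
      nlinarith [mul_pos ht hε, norm_nonneg v₀]
    have h7 : 0 ≤ t * ((A k v₀) i + ε) := by linarith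
    exact nonneg_of_mul_nonneg_right h7 ht
  borelize K
  let μ : Measure K := haarMeasure ⊤
  have : IsProbabilityMeasure μ := ⟨haarMeasure_self (K₀ := (⊤ : TopologicalSpace.PositiveCompacts K))⟩
  obtain ⟨v, hv, hvpos⟩ := exists_fixed_vector_pos A hA v₀
  have hvi : ∀ i, p i = 0 → 0 < v i := fun i hi =>
    hvpos (EuclideanSpace.proj i) (hv₀ i hi) (by simp [v₀])
  obtain ⟨t₀, ht₀, ht₀Q⟩ : ∃ t₀ : ℝ, 0 < t₀ ∧ p + t₀ • v ∈ interior Q := by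
    have : ∀ᶠ t : ℝ in 𝓝[>] 0, ∀ i, 0 < (p + t • v) i := by
      rw [eventually_all]
      intro i
      by_cases hi : p i = 0
      · filter_upwards [self_mem_nhdsWithin] with t (ht : 0 < t)
        have := hvi i hi
        simp [hi]
        positivity
      · have h1 : Tendsto (fun t : ℝ => (p + t • v) i) (𝓝 0) (𝓝 ((p + (0 : ℝ) • v) i)) :=
          Continuous.tendsto (by fun_prop) _
        rw [zero_smul, add_zero] at h1
        have hpi : 0 < p i := lt_of_le_of_ne (by rw [hQ] at hpQ; exact hpQ i) (Ne.symm hi)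
        exact (h1.eventually (lt_mem_nhds hpi)).filter_mono nhdsWithin_le_nhds
    obtain ⟨t, ht, ht0⟩ := (this.and self_mem_nhdsWithin).exists
    exact ⟨t, ht0, (hint _).2 ht⟩
  obtain ⟨c, hc, hcQ⟩ := exists_closedBall_add_smul_subset hconv hpQ ht₀ ht₀Q
  -- the averaged coordinates are close to `e`
  let δ : NNReal := (min (1 / 2) (c / (2 * (‖v‖ + 1)))).toNNReal
  have hδ : (δ : ℝ) = min (1 / 2) (c / (2 * (‖v‖ + 1))) := Real.coe_toNNReal _ (by positivity)
  have hδ0 : 0 < δ := by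
    rw [← NNReal.coe_pos, hδ]; positivity
  have hδ1 : (δ : ℝ) ≤ 1 / 2 := hδ ▸ min_le_left _ _
  have hδ2 : (δ : ℝ) * ‖v‖ ≤ c / 2 := by
    have h : (δ : ℝ) ≤ c / (2 * (‖v‖ + 1)) := hδ ▸ min_le_right _ _
    calc (δ : ℝ) * ‖v‖ ≤ c / (2 * (‖v‖ + 1)) * (‖v‖ + 1) := by gcongr; linarith
      _ = c / 2 := by field_simp
  obtain ⟨r, hr, hball⟩ : ∃ r > 0, ∀ y ∈ ball p r ∩ Q, ∀ y' ∈ ball p r ∩ Q,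
      ((∀ k : K, ‖e (k • e.symm y) - e (k • e.symm y') - A k (y - y')‖ ≤ (δ / C : NNReal) * ‖y - y'‖)
        ∧ ∀ k : K, k • e.symm y ∈ e.source) ∧ y ∈ e.target := by
    -- Dividing by `C` compensates for the factor lost in averaging.
    have h := ((huniform (δ / C : NNReal) (by positivity)).and
      (hsource.prod_inl (𝓝[Q] p))).and (Filter.Eventually.prod_inl htarget (𝓝[Q] p))
    obtain ⟨r, hr, h⟩ := (nhdsWithin_basis_ball.prod_self).eventually_iff.1 h
    exact ⟨r, hr, fun y hy y' hy' => h (x := (y, y')) ⟨hy, hy'⟩⟩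
  let f : X → EuclideanSpace ℝ (Fin n) := equivariantAverage μ A fun z => e z - p
  have hcont : ∀ z : X, (∀ k : K, k • z ∈ e.source) → Continuous fun k : K => e (k • z) - p :=
    fun z hz => (hec.comp_continuous (by fun_prop) hz).sub continuous_const
  have happrox : ApproximatesLinearOn (fun y => f (e.symm y))
      (ContinuousLinearMap.id ℝ (EuclideanSpace ℝ (Fin n))) (ball p r ∩ Q) δ := by
    have := equivariantAverage_approximatesLinearOn (ε := δ / C) μ A hA (fun z => e z - p) e.symm
      (ball p r ∩ Q) hC (fun y hy => hcont _ (hball y hy y hy).1.2) fun k y hy y' hy' => by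
        simpa only [sub_sub_sub_cancel_right] using (hball y hy y' hy').1.1 k
    rwa [mul_div_cancel₀ _ hC0.ne'] at this
  have hinj : ∀ y ∈ ball p r ∩ Q, ∀ y' ∈ ball p r ∩ Q, f (e.symm y) = f (e.symm y') → y = y' := by
    intro y hy y' hy' h
    have h1 := happrox y hy y' hy'
    simp only [h, sub_self, zero_sub, norm_neg, ContinuousLinearMap.id_apply] at h1
    have : ‖y - y'‖ = 0 := by nlinarith [norm_nonneg (y - y')]
    exact sub_eq_zero.1 (norm_eq_zero.1 this)
  have hfp : f (e.symm p) = 0 := by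
    simp [f, equivariantAverage, hsymm_p, hfix, ← hp]
  have hpr : p ∈ ball p r ∩ Q := ⟨mem_ball_self hr, hpQ⟩
  -- The smaller radius keeps whole orbits in the ball where `f` is injective.
  obtain ⟨r', hr', hball'⟩ : ∃ r' > 0, ∀ y ∈ ball p r' ∩ Q, ∀ k : K,
      e (k • e.symm y) ∈ ball p r := by
    have : ∀ᶠ y in 𝓝[Q] p, ∀ k : K, e (k • e.symm y) ∈ ball p r :=
      eventually_forall_of_compactSpace fun k =>
        (((hec.continuousAt (he.mem_nhds hx)).tendsto).comp (hact k)).eventually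
          (ball_mem_nhds _ hr)
    exact nhdsWithin_basis_ball.eventually_iff.1 this
  obtain ⟨t, ht, htt₀, htr⟩ : ∃ t : ℝ, 0 < t ∧ t ≤ t₀ ∧ closedBall (p + t • v) (t * c) ⊆
      ball p (min r r') := by
    have : 0 < min r r' := lt_min hr hr'
    refine ⟨min t₀ (min r r' / (2 * (‖v‖ + c))), by positivity, min_le_left _ _, ?_⟩
    set t := min t₀ (min r r' / (2 * (‖v‖ + c)))
    have ht : 0 < t := by positivity
    have h1 : t * (‖v‖ + c) ≤ min r r' / 2 := by
      calc t * (‖v‖ + c) ≤ min r r' / (2 * (‖v‖ + c)) * (‖v‖ + c) := by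
            gcongr; exact min_le_right _ _
        _ = min r r' / 2 := by field_simp
    refine closedBall_subset_ball' ?_
    rw [dist_eq_norm, add_sub_cancel_left, norm_smul, Real.norm_of_nonneg ht.le]
    linarith
  have hsub := hcQ t ht htt₀
  have hsubr : closedBall (p + t • v) (t * c) ⊆ ball p r ∩ Q := fun y hy =>
    ⟨ball_subset_ball (min_le_left _ _) (htr hy), interior_subset (hsub hy)⟩
  let R : (ContinuousLinearMap.id ℝ (EuclideanSpace ℝ (Fin n))).NonlinearRightInverse :=
    { toFun := id, nnnorm := 1, bound' := by simp, right_inv' := by simp }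
  -- The image contains the ball of radius `(1 - δ) * (t * c) ≥ t * c / 2` around the value at `p +
  -- t • v`, and that value is within `δ * t * ‖v‖ ≤ t * c / 2` of `t • v`.
  have hsurj := happrox.surjOn_closedBall_of_nonlinearRightInverse R (by positivity) hsubr
  obtain ⟨y, hy, hyv⟩ : t • v ∈ (fun y => f (e.symm y)) '' closedBall (p + t • v) (t * c) := by
    apply hsurj
    have hb := happrox _ (hsubr (mem_closedBall_self (by positivity))) p hpr
    simp only [hfp, sub_zero, add_sub_cancel_left, ContinuousLinearMap.id_apply, norm_smul,
      Real.norm_of_nonneg ht.le] at hb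
    rw [mem_closedBall, dist_comm, dist_eq_norm]
    refine hb.trans ?_
    simp only [R, NNReal.coe_one, inv_one]
    nlinarith [mul_pos ht hc]
  have hyr := hsubr hy
  have hyr' : y ∈ ball p r' ∩ Q := ⟨ball_subset_ball (min_le_right _ _) (htr hy), hyr.2⟩
  obtain ⟨⟨-, hys⟩, hyt⟩ := hball y hyr y hyr
  refine ⟨e.symm y, e.map_target hyt, fun l => ?_, by rw [e.right_inv hyt]; exact hsub hy⟩
  -- Both points have the same value under `f`, since `A l` fixes `t • v`.
  have h1 : e (l • e.symm y) = y := by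
    refine hinj _ ⟨hball' y hyr' l, hmaps (hys l)⟩ _ hyr ?_
    rw [e.left_inv (hys l)]
    refine (equivariantAverage_smul μ A hA _ _ (hcont _ hys) l).trans ?_
    change A l (f (e.symm y)) = f (e.symm y)
    simp only at hyv
    rw [hyv, map_smul, hv]
  rw [← e.left_inv (hys l), h1]

/-! ### Strict differentiability up to the boundary -/

/-- The mean value inequality on the convex set `ball a r ∩ s`, where the derivative varies by less
than `ε`. -/
theorem ContDiffWithinAt.eventually_norm_sub_sub_le {E F : Type*} [NormedAddCommGroup E]
    [NormedSpace ℝ E] [NormedAddCommGroup F] [NormedSpace ℝ F] {f : E → F} {s : Set E} {a : E}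
    (hf : ContDiffWithinAt ℝ 1 f s a) (hs : Convex ℝ s) (hu : UniqueDiffOn ℝ s) (ha : a ∈ s)
    {ε : ℝ} (hε : 0 < ε) :
    ∀ᶠ q in 𝓝[s] a ×ˢ 𝓝[s] a,
      ‖f q.1 - f q.2 - fderivWithin ℝ f s a (q.1 - q.2)‖ ≤ ε * ‖q.1 - q.2‖ := by
  have h1 : Tendsto (fun y => ‖fderivWithin ℝ f s y - fderivWithin ℝ f s a‖) (𝓝[s] a) (𝓝 0) := by
    have h : ContinuousWithinAt (fderivWithin ℝ f s) s a :=
      (hf.fderivWithin_right (m := 0) hu (by simp) ha).continuousWithinAt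
    exact tendsto_iff_norm_sub_tendsto_zero.1 h
  obtain ⟨u, huo, hau, hfu⟩ := hf.contDiffOn' le_rfl (by simp)
  have h2 : ∀ᶠ y in 𝓝[s] a, DifferentiableWithinAt ℝ f s y := by
    filter_upwards [self_mem_nhdsWithin, nhdsWithin_le_nhds (huo.mem_nhds hau)] with y hys hyu
    rw [insert_eq_of_mem ha] at hfu
    exact (differentiableWithinAt_inter (huo.mem_nhds hyu)).1
      ((hfu.differentiableOn one_ne_zero) y ⟨hys, hyu⟩)
  obtain ⟨r, hr, h⟩ := nhdsWithin_basis_ball.eventually_iff.1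
    (h2.and (h1.eventually (gt_mem_nhds hε)))
  refine (nhdsWithin_basis_ball.prod_self).eventually_iff.2 ⟨r, hr, fun q hq => ?_⟩
  exact ((convex_ball a r).inter hs).norm_image_sub_le_of_norm_hasFDerivWithin_le'
    (fun y hy => (h hy).1.hasFDerivWithinAt.mono inter_subset_right) (fun y hy => (h hy).2.le)
    hq.2 hq.1

/-- Near a point fixed by `g`, the action map in coordinates is strictly differentiable in the
space variable, uniformly in the group element. -/
theorem exists_strict_derivative_smul {E : Type*} [NormedAddCommGroup E] [NormedSpace ℝ E]
    {H : Type*} [TopologicalSpace H] (I : ModelWithCorners ℝ E H)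
    {F : Type*} [NormedAddCommGroup F] [NormedSpace ℝ F]
    {H' : Type*} [TopologicalSpace H'] (J : ModelWithCorners ℝ F H')
    {G : Type*} [TopologicalSpace G] [ChartedSpace H G]
    {M : Type*} [TopologicalSpace M] [ChartedSpace H' M] [SMul G M] [ContMDiffSMul I J 1 G M]
    {g : G} {x : M} (hg : g • x = x) :
    ∃ D : F →L[ℝ] F, ∀ ε > 0,
      ∀ᶠ q in 𝓝 g ×ˢ (𝓝[range J] extChartAt J x x ×ˢ 𝓝[range J] extChartAt J x x),
      ‖extChartAt J x (q.1 • (extChartAt J x).symm q.2.1)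
        - extChartAt J x (q.1 • (extChartAt J x).symm q.2.2) - D (q.2.1 - q.2.2)‖ ≤
        ε * ‖q.2.1 - q.2.2‖ := by
  have h : ContMDiffAt (I.prod J) J 1 (fun p : G × M => p.1 • p.2) (g, x) :=
    contMDiff_smul.contMDiffAt
  have h1 := (contMDiffAt_iff.1 h).2
  simp only [hg] at h1
  set f := (extChartAt J x : M → F) ∘ (fun p : G × M => p.1 • p.2) ∘
    (extChartAt (I.prod J) (g, x)).symm with hf
  have ha : extChartAt (I.prod J) (g, x) (g, x) = (extChartAt I g g, extChartAt J x x) := rfl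
  refine ⟨fderivWithin ℝ f (range (I.prod J)) (extChartAt (I.prod J) (g, x) (g, x)) ∘L
    ContinuousLinearMap.inr ℝ E F, fun ε hε => ?_⟩
  have h2 := h1.eventually_norm_sub_sub_le (I.prod J).convex_range (I.prod J).uniqueDiffOn
    (mem_range_self _) hε
  have hψ : Tendsto (extChartAt I g) (𝓝 g) (𝓝[range I] extChartAt I g g) :=
    tendsto_nhdsWithin_iff.2 ⟨(continuousAt_extChartAt g), Eventually.of_forall fun y =>
      mem_range_self _⟩
  have h3 : Tendsto (fun q : G × F × F => ((extChartAt I g q.1, q.2.1), (extChartAt I g q.1, q.2.2)))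
      (𝓝 g ×ˢ (𝓝[range J] extChartAt J x x ×ˢ 𝓝[range J] extChartAt J x x))
      (𝓝[range (I.prod J)] extChartAt (I.prod J) (g, x) (g, x) ×ˢ
        𝓝[range (I.prod J)] extChartAt (I.prod J) (g, x) (g, x)) := by
    rw [ha, modelWithCorners_prod_coe, range_prodMap, nhdsWithin_prod_eq]
    have t1 := hψ.comp (tendsto_fst (f := 𝓝 g)
      (g := 𝓝[range J] extChartAt J x x ×ˢ 𝓝[range J] extChartAt J x x))
    exact (t1.prodMk (tendsto_fst.comp tendsto_snd)).prodMk
      (t1.prodMk (tendsto_snd.comp tendsto_snd))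
  filter_upwards [h3.eventually h2,
    Filter.Eventually.prod_inl (extChartAt_source_mem_nhds (I := I) g) _] with ⟨k, y, y'⟩ h4 h5
  have h6 : (extChartAt I g).symm (extChartAt I g k) = k := (extChartAt I g).left_inv h5
  have h7 : ∀ y, f (extChartAt I g k, y) = extChartAt J x (k • (extChartAt J x).symm y) := by
    intro y
    simp only [hf, extChartAt_prod, Function.comp_apply, PartialEquiv.prod_symm,
      PartialEquiv.prod_coe, h6]
  have h8 : ((extChartAt I g k, y) : E × F) - (extChartAt I g k, y') = (0, y - y') := by simp
  simp only [h7, h8] at h4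
  simpa using h4

/-! ### The isotropy representation -/

section Representation

variable {n : ℕ} {K : Type*} [TopologicalSpace K]

/-- It suffices to test on basis vectors. These point into `Q`, so for `l` near `k` a single
difference quotient of `Φ l` approximates both `D l w` and `D k w`. -/
theorem continuous_of_strict_derivative {Φ : K → EuclideanSpace ℝ (Fin n) →
    EuclideanSpace ℝ (Fin n)} {Q : Set (EuclideanSpace ℝ (Fin n))}
    (hQ : Q = {y | ∀ i, 0 ≤ y i}) {p : EuclideanSpace ℝ (Fin n)} (hp : p ∈ Q)
    {D : K → EuclideanSpace ℝ (Fin n) →L[ℝ] EuclideanSpace ℝ (Fin n)}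
    (hd : ∀ k, ∀ ε > 0, ∀ᶠ q in 𝓝 k ×ˢ (𝓝[Q] p ×ˢ 𝓝[Q] p),
      ‖Φ q.1 q.2.1 - Φ q.1 q.2.2 - D k (q.2.1 - q.2.2)‖ ≤ ε * ‖q.2.1 - q.2.2‖) :
    Continuous D := by
  have key : ∀ i, Continuous fun k => D k (EuclideanSpace.single i 1) := by
    intro i
    set w : EuclideanSpace ℝ (Fin n) := EuclideanSpace.single i 1 with hw
    have hw1 : ‖w‖ = 1 := by simp [hw]
    have hline : Tendsto (fun t : ℝ => (p + t • w, p)) (𝓝[>] 0) (𝓝[Q] p ×ˢ 𝓝[Q] p) := by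
      refine Tendsto.prodMk (tendsto_nhdsWithin_iff.2 ⟨?_, ?_⟩) (tendsto_const_nhdsWithin hp)
      · have : Tendsto (fun t : ℝ => p + t • w) (𝓝 0) (𝓝 (p + (0 : ℝ) • w)) :=
          Continuous.tendsto (by fun_prop) _
        rw [zero_smul, add_zero] at this
        exact this.mono_left nhdsWithin_le_nhds
      · filter_upwards [self_mem_nhdsWithin] with t (ht : 0 < t)
        rw [hQ] at hp ⊢
        intro j
        have h1 := hp j
        have h2 : 0 ≤ w j := by
          rw [hw, PiLp.single_apply]
          split_ifs <;> norm_num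
        simp only [PiLp.add_apply, PiLp.smul_apply, smul_eq_mul]
        positivity
    refine continuous_iff_continuousAt.2 fun k => Metric.tendsto_nhds.2 fun ε hε => ?_
    have hε3 : 0 < ε / 3 := by positivity
    filter_upwards [(hd k _ hε3).curry] with l hl
    have hl' : ∀ᶠ q in 𝓝[Q] p ×ˢ 𝓝[Q] p,
        ‖Φ l q.1 - Φ l q.2 - D l (q.1 - q.2)‖ ≤ ε / 3 * ‖q.1 - q.2‖ :=
      (hd l _ hε3).curry.self_of_nhds
    obtain ⟨t, ⟨h1, h2⟩, ht⟩ := ((hline.eventually (hl.and hl')).and self_mem_nhdsWithin).exists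
    replace ht : 0 < t := ht
    simp only [add_sub_cancel_left, norm_smul, hw1, Real.norm_of_nonneg ht.le, mul_one,
      map_smul] at h1 h2
    have h3 : ‖t • (D l w - D k w)‖ ≤ ε / 3 * t + ε / 3 * t := by
      refine le_trans ?_ ((norm_sub_le _ _).trans (add_le_add h1 h2))
      apply le_of_eq
      congr 1
      rw [smul_sub]
      abel
    rw [norm_smul, Real.norm_of_nonneg ht.le] at h3
    rw [dist_eq_norm]
    nlinarith
  refine continuous_clm_apply.2 fun w => ?_
  have hsum : ∀ k, D k w = ∑ i, w i • D k (EuclideanSpace.single i 1) := by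
    intro k
    conv_lhs => rw [← (EuclideanSpace.basisFun (Fin n) ℝ).sum_repr w]
    simp
  simp only [hsum]
  exact continuous_finsetSum _ fun i _ => (continuous_const (y := w i)).smul (key i)

/-- The derivatives at a common fixed point of a group action, read in coordinates, form a
continuous representation. -/
theorem exists_monoidHom_of_strict_derivative [Group K] {X : Type*} [TopologicalSpace X]
    [MulAction K X] [ContinuousSMul K X] (e : PartialEquiv X (EuclideanSpace ℝ (Fin n)))
    (he : IsOpen e.source) {x : X} (hx : x ∈ e.source)
    (hfix : ∀ k : K, k • x = x) {Q : Set (EuclideanSpace ℝ (Fin n))}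
    (hQ : Q = {y | ∀ i, 0 ≤ y i}) (hu : UniqueDiffOn ℝ Q) (hmaps : MapsTo e e.source Q)
    (htarget : e.target ∈ 𝓝[Q] e x) (hsymm : ContinuousWithinAt e.symm Q (e x))
    (D : K → (EuclideanSpace ℝ (Fin n) →L[ℝ] EuclideanSpace ℝ (Fin n)))
    (hd : ∀ k, ∀ ε > 0, ∀ᶠ q in 𝓝 k ×ˢ (𝓝[Q] e x ×ˢ 𝓝[Q] e x),
      ‖e (q.1 • e.symm q.2.1) - e (q.1 • e.symm q.2.2) - D k (q.2.1 - q.2.2)‖ ≤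
        ε * ‖q.2.1 - q.2.2‖) :
    ∃ A : K →* (EuclideanSpace ℝ (Fin n) →L[ℝ] EuclideanSpace ℝ (Fin n)),
      Continuous A ∧ ∀ k, A k = D k := by
  have hpQ : e x ∈ Q := hmaps hx
  have hsymm_p : e.symm (e x) = x := e.left_inv hx
  have hder : ∀ k, HasFDerivWithinAt (fun y => e (k • e.symm y)) (D k) Q (e x) := by
    intro k
    refine HasFDerivWithinAt.of_isLittleO (Asymptotics.isLittleO_iff.2 fun ε hε => ?_)
    exact (tendsto_id.prodMk (tendsto_const_nhdsWithin hpQ)).eventually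
      (hd k ε hε).curry.self_of_nhds
  have h1 : D 1 = 1 := by
    refine (hu _ hpQ).eq (hder 1) ((hasFDerivWithinAt_id (𝕜 := ℝ) (e x) Q).congr_of_eventuallyEq ?_ ?_)
    · filter_upwards [htarget] with y hy
      simp [e.right_inv hy]
    · simp [hsymm_p]
  have hmul : ∀ k l, D (k * l) = D k * D l := by
    intro k l
    have hsource : {y | l • e.symm y ∈ e.source} ∈ 𝓝[Q] e x := by
      have : Tendsto (fun y => l • e.symm y) (𝓝[Q] e x) (𝓝 x) := by
        have := hsymm.tendsto.const_smul l
        rwa [hsymm_p, hfix] at this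
      exact this.eventually (he.mem_nhds hx)
    have hsub := (hu _ hpQ).inter' hsource
    have hk : HasFDerivWithinAt (fun y => e (k • e.symm y)) (D k) Q (e (l • e.symm (e x))) := by
      rw [hsymm_p, hfix]; exact hder k
    have hcomp := hk.comp (e x) ((hder l).mono inter_subset_left)
      (t := Q) (s := Q ∩ {y | l • e.symm y ∈ e.source}) fun y hy => hmaps hy.2
    refine hsub.eq ((hder (k * l)).mono inter_subset_left) (hcomp.congr ?_ ?_)
    · intro y hy
      simp [e.left_inv hy.2, mul_smul]
    · simp [hsymm_p, hfix]
  refine ⟨{ toFun := D, map_one' := h1, map_mul' := hmul }, ?_, fun _ => rfl⟩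
  exact continuous_of_strict_derivative (Φ := fun k y => e (k • e.symm y)) hQ hpQ hd

end Representation

/-! ### Interior points and conclusion -/

/-- Being interior does not depend on the chart, so the chart at `x` can be used to test `z`. -/
theorem isInteriorPoint_of_extChartAt_mem_interior_range {E : Type*} [NormedAddCommGroup E]
    [NormedSpace ℝ E] [FiniteDimensional ℝ E] {H : Type*} [TopologicalSpace H]
    (I : ModelWithCorners ℝ E H) {M : Type*} [TopologicalSpace M] [ChartedSpace H M]
    [IsManifold I ∞ M] {x z : M} (hz : z ∈ (extChartAt I x).source)
    (h : extChartAt I x z ∈ interior (range I)) : I.IsInteriorPoint z := by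
  refine (ModelWithCorners.isInteriorPoint_iff_of_mem_atlas (n := ∞) (by simp)
    (chart_mem_atlas H x) (by simpa using hz)).2 ?_
  have h1 := extChartAt_target_mem_nhdsWithin_of_mem ((extChartAt I x).map_source hz)
  rw [nhdsWithin_eq_nhds.2 (mem_interior_iff_mem_nhds.1 h)] at h1
  exact mem_interior_iff_mem_nhds.2 h1

theorem mainTheorem8
    -- a compact Lie group `G`
    {E : Type*} [NormedAddCommGroup E] [NormedSpace ℝ E] [FiniteDimensional ℝ E]
    {H : Type*} [TopologicalSpace H] (I : ModelWithCorners ℝ E H) [I.Boundaryless]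
    (G : Type*) [Group G] [TopologicalSpace G] [ChartedSpace H G] [LieGroup I ∞ G]
    [CompactSpace G]
    -- a compact (Hausdorff) smooth `n`-dimensional manifold with corners `M`
    (n : ℕ)
    (M : Type*) [TopologicalSpace M] [T2Space M] [CompactSpace M]
    [ChartedSpace (EuclideanQuadrant n) M]
    [IsManifold (modelWithCornersEuclideanQuadrant n) ∞ M]
    -- a smooth action of `G` on `M`
    [MulAction G M] [ContMDiffSMul I (modelWithCornersEuclideanQuadrant n) ∞ G M]
    (hfree : ActsFreelyOn G ((modelWithCornersEuclideanQuadrant n).interior M)) :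
    ActsFreelyOn G (Set.univ : Set M) := by
  intro x _
  set J := modelWithCornersEuclideanQuadrant n
  have : IsTopologicalGroup G := topologicalGroup_of_lieGroup I ∞
  have : ContinuousSMul G M := ContMDiffSMul.continuousSMul (I := I) (I' := J) ∞
  have : CompactSpace (MulAction.stabilizer G x) := by
    refine isCompact_iff_compactSpace.1 (IsClosed.isCompact ?_)
    exact isClosed_eq (f := fun g : G => g • x) (by fun_prop) continuous_const
  have hfix : ∀ k : MulAction.stabilizer G x, k • x = x := fun k => k.2
  have hQ : range J = {y | ∀ i, 0 ≤ y i} := range_euclideanQuadrant n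
  have hmaps : MapsTo (extChartAt J x) (extChartAt J x).source (range J) :=
    fun z _ => mem_range_self _
  have hsymm : ContinuousWithinAt (extChartAt J x).symm (range J) (extChartAt J x x) :=
    (continuousAt_extChartAt_symm x).continuousWithinAt
  choose D hD using fun k : MulAction.stabilizer G x =>
    exists_strict_derivative_smul I J (g := (k : G)) (x := x) k.2
  have hd : ∀ k : MulAction.stabilizer G x, ∀ ε > 0,
      ∀ᶠ q in 𝓝 k ×ˢ (𝓝[range J] extChartAt J x x ×ˢ 𝓝[range J] extChartAt J x x),
      ‖extChartAt J x (q.1 • (extChartAt J x).symm q.2.1)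
        - extChartAt J x (q.1 • (extChartAt J x).symm q.2.2) - D k (q.2.1 - q.2.2)‖ ≤
        ε * ‖q.2.1 - q.2.2‖ := fun k ε hε =>
    ((continuous_subtype_val.tendsto k).prodMap tendsto_id).eventually (hD k ε hε)
  obtain ⟨A, hA, hAD⟩ := exists_monoidHom_of_strict_derivative (extChartAt J x)
    (isOpen_extChartAt_source x) (mem_extChartAt_source x) hfix hQ J.uniqueDiffOn hmaps
    (extChartAt_target_mem_nhdsWithin x) hsymm D hd
  obtain ⟨z, hzs, hz, hzQ⟩ := exists_fixed_point_pos (extChartAt J x)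
    (isOpen_extChartAt_source x) (continuousOn_extChartAt x) (mem_extChartAt_source x) hfix hQ
    hmaps (extChartAt_target_mem_nhdsWithin x) hsymm A hA (by simpa only [hAD] using hd)
  have hzfree := hfree z (isInteriorPoint_of_extChartAt_mem_interior_range J hzs hzQ)
  rw [eq_bot_iff, ← hzfree]
  exact fun g hg => hz ⟨g, hg⟩
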